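/- Let $S^2\subset\mathbb{R}^3$ be the unit sphere with its area measure $dx$ (total mass $4\pi$), $\nu=(0,0,1)$ the north pole, and $du$ the Haar measure on $\mathbf{SO}(3)$ of total mass $8\pi^2$ (that is, $du=\sin\beta\,d\alpha\,d\beta\,d\gamma$ in ZYZ Euler angles). Fix a phase convention $\varepsilon\in\{1,-1\}$. *Matrix elements.* For an integer $\ell\ge 0$, let $\mathbf{SU}(2)$ act on complex polynomials of degree at most $2\ell$ by $(\rho_\ell(g)Q)(x)=(-bx+a)^{2\ell}\,Q\!\left(\frac{dx-c}{-bx+a}\right)$ for $g=\begin{pmatrix}a&c\\ b&d\end{pmatrix}$, with the invariant inner product for which the monomials are orthogonal and $\langle x^{\ell-m},x^{\ell-m}\rangle=(\ell-m)!\,(\ell+m)!$ for $-\ell\le m\le\ell$, and with the orthonormal basis $\psi_m=\varepsilon^m x^{\ell-m}/\sqrt{(\ell-m)!\,(\ell+m)!}$. Put $\rho_\ell^{mn}(g)=\langle\rho_\ell(g)\psi_n,\psi_m\rangle$ for $-\ell\le m,n\le\ell$. Since $\rho_\ell(-g)=\rho_\ell(g)$, these are functions on $\mathbf{SO}(3)$,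 through the double cover $\mathbf{SU}(2)\to\mathbf{SO}(3)$, $g\mapsto u$, given by $(uy)\cdot\sigma=g\,(y\cdot\sigma)\,g^*$ for $y\in\mathbb{R}^3$, where $\sigma=(\sigma_1,\sigma_2,\sigma_3)$ are the Pauli matrices. They are the matrix elements (Wigner $D$-matrix elements) of the irreducible unitary representations of $\mathbf{SO}(3)$. *Spherical harmonics.* For $x=(\sin\theta\cos\phi,\sin\theta\sin\phi,\cos\theta)\in S^2$ and $-\ell\le m\le\ell$ let $$Y_m^\ell(x)=\sqrt{\frac{2\ell+1}{4\pi}\,\frac{(\ell-m)!}{(\ell+m)!}}\;P_m^\ell(\cos\theta)\,e^{im\phi},\qquad P_m^\ell(t)=\frac{(-1)^{\ell}\varepsilon^m}{2^\ell\,\ell!}\,(1-t^2)^{m/2}\,\frac{d^{\ell+m}}{dt^{\ell+m}}(1-t^2)^\ell$$ (extended continuously to $t=\pm1$), and for $f\in L^2(S^2)$ let $\hat f_m^\ell=\int_{S^2}f(x)\,\overline{Y_m^\ell(x)}\,dx$. (For $\varepsilon=-1$ these are the standard Wigner $D$-matrices and spherical harmonics with the Condon–Shortley phase; for $\varepsilon=1$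 the basis $\psi_m$ carries no signs and neither does $P_m^\ell$ carry the Condon–Shortley phase.) *Statement.* For every $f\in L^2(S^2)$ with values in $\mathbb{C}$, all integers $\ell\ge0$ and $-\ell\le m,n\le\ell$, and either choice of $\varepsilon$, the integrals below and that defining $\hat f_n^\ell$ converge absolutely, and $$\int_{\mathbf{SO}(3)}f(u\nu)\,\overline{\rho_\ell^{mn}(u^{-1})}\,du=\begin{cases}2\pi\sqrt{\dfrac{4\pi}{2\ell+1}}\;\hat f_n^\ell,& m=0,\\[2mm] 0,& m\neq0.\end{cases}$$ -/

import Mathlib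

open MeasureTheory
open scoped ComplexConjugate

noncomputable section

/-! ## The rotation group `SO(3)`, its Haar measure, and the sphere -/

/-- The rotation group `SO(3)`: real orthogonal `3 × 3` matrices of determinant one. -/
abbrev SO3 : Type := Matrix.specialOrthogonalGroup (Fin 3) ℝ

/-- The group `SU(2)`: unitary `2 × 2` matrices of determinant one. -/
abbrev SU2 : Type := Matrix.specialUnitaryGroup (Fin 2) ℂ

instance instMeasurableSpaceSO3 : MeasurableSpace SO3 := borel SO3

instance instBorelSpaceSO3 : BorelSpace SO3 := ⟨rfl⟩

instance instIsTopologicalGroupSO3 : IsTopologicalGroup SO3 where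
  continuous_mul := by
    refine Continuous.subtype_mk ?_ _
    exact (continuous_subtype_val.comp continuous_fst).matrix_mul
      (continuous_subtype_val.comp continuous_snd)
  continuous_inv := by
    refine Continuous.subtype_mk ?_ _
    exact continuous_subtype_val.star

instance instCompactSpaceSO3 : CompactSpace SO3 := by
  refine isCompact_iff_compactSpace.mp
    (IsCompact.of_isClosed_subset (isCompact_univ_pi fun _ : Fin 3 =>
      isCompact_univ_pi fun _ : Fin 3 => isCompact_Icc (a := (-1 : ℝ)) (b := 1)) ?_ ?_)
  · have h : ((Matrix.specialOrthogonalGroup (Fin 3) ℝ : Submonoid _) :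
        Set (Matrix (Fin 3) (Fin 3) ℝ)) = {A | A * star A = 1} ∩ {A | A.det = 1} := by
      ext A
      simp [Matrix.mem_specialOrthogonalGroup_iff, Matrix.mem_orthogonalGroup_iff,
        Matrix.star_eq_conjTranspose]
    exact h ▸ (isClosed_eq (by fun_prop) continuous_const).inter
      (isClosed_eq (by fun_prop) continuous_const)
  · intro A hA i _ j _
    have hA' := (Matrix.mem_specialOrthogonalGroup_iff.mp hA).1
    have h1 : ‖A i j‖ ≤ 1 := entry_norm_bound_of_unitary hA' i j
    exact abs_le.mp h1

/-- The invariant measure `du = sin β dα dβ dγ` on `SO(3)` (in ZYZ Euler angles): the Haar measure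
of total mass `8π² = 4π · 2π`, i.e. the area of `S²` times the length of the circle `SO(2)`. -/
def haarSO3 : Measure SO3 :=
  ENNReal.ofReal (8 * Real.pi ^ 2) • Measure.haarMeasure (⊤ : TopologicalSpace.PositiveCompacts SO3)

/-- The unit sphere `S²` in Euclidean space `ℝ³`. -/
abbrev S2 : Type := Metric.sphere (0 : EuclideanSpace ℝ (Fin 3)) 1

/-- The surface (area) measure on `S²`. -/
def areaS2 : Measure S2 := (volume : Measure (EuclideanSpace ℝ (Fin 3))).toSphere

/-- The north pole `ν = (0, 0, 1)`. -/
def northPole : S2 := ⟨!₂[0, 0, 1], by simp [EuclideanSpace.norm_eq, Fin.sum_univ_three]⟩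

lemma norm_rotateS2 (u : SO3) (x : EuclideanSpace ℝ (Fin 3)) :
    ‖WithLp.toLp 2 (u.1.mulVec x.ofLp)‖ = ‖x‖ := by
  have hu : u.1.transpose * u.1 = 1 :=
    (Matrix.mem_orthogonalGroup_iff' (Fin 3) ℝ).mp
      (Matrix.mem_specialOrthogonalGroup_iff.mp u.2).1
  rw [← sq_eq_sq₀ (norm_nonneg _) (norm_nonneg _), EuclideanSpace.real_norm_sq_eq,
    EuclideanSpace.real_norm_sq_eq]
  have h : dotProduct (u.1.mulVec x.ofLp) (u.1.mulVec x.ofLp) = dotProduct x.ofLp x.ofLp := by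
    rw [Matrix.dotProduct_mulVec, Matrix.vecMul_mulVec, ← Matrix.mulVec_transpose]
    simp [hu]
  simpa [dotProduct, sq] using h

/-- The action `u x` of a rotation `u` on a point `x` of the sphere. -/
def rotateS2 (u : SO3) (x : S2) : S2 :=
  ⟨WithLp.toLp 2 (u.1.mulVec x.1.ofLp), by
    rw [mem_sphere_zero_iff_norm, norm_rotateS2]; exact mem_sphere_zero_iff_norm.mp x.2⟩

/-! ## The double cover `SU(2) → SO(3)` -/

/-- The traceless Hermitian matrix `x₁σ₁ + x₂σ₂ + x₃σ₃` attached to `x ∈ ℝ³` (Pauli matrices). -/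
def pauli (x : Fin 3 → ℝ) : Matrix (Fin 2) (Fin 2) ℂ :=
  !![(x 2 : ℂ), (x 0 : ℂ) - Complex.I * x 1; (x 0 : ℂ) + Complex.I * x 1, -(x 2 : ℂ)]

/-- `g ∈ SU(2)` lies over `u ∈ SO(3)` under the double cover `SU(2) → SO(3)`, that is,
`(u x) · σ = g (x · σ) g*` for all `x ∈ ℝ³`. -/
def Covers (g : SU2) (u : SO3) : Prop :=
  ∀ x : Fin 3 → ℝ, pauli (u.1.mulVec x) = g.1 * pauli x * g.1.conjTranspose

lemma Covers.mul {g h : SU2} {u v : SO3} (hg : Covers g u) (hh : Covers h v) :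
    Covers (g * h) (u * v) := by
  intro x
  have h1 := hg (v.1.mulVec x)
  rw [hh x, Matrix.mulVec_mulVec] at h1
  simpa [Matrix.mul_assoc, Matrix.conjTranspose_mul] using h1

/-- `diag(e^{-iα/2}, e^{iα/2}) ∈ SU(2)`. -/
def su2Z (α : ℝ) : SU2 :=
  ⟨!![(Real.cos (α / 2) : ℂ) - Real.sin (α / 2) * Complex.I, 0;
      0, (Real.cos (α / 2) : ℂ) + Real.sin (α / 2) * Complex.I], by
    have h : (Real.cos (α / 2) : ℂ) ^ 2 + (Real.sin (α / 2) : ℂ) ^ 2 = 1 := by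
      exact_mod_cast Real.cos_sq_add_sin_sq (α / 2)
    rw [Matrix.mem_specialUnitaryGroup_iff, Matrix.mem_unitaryGroup_iff]
    constructor
    · ext i j
      fin_cases i <;> fin_cases j <;>
        simp [Matrix.mul_apply, Fin.sum_univ_two, Matrix.star_apply, -Complex.ofReal_cos,
          -Complex.ofReal_sin] <;>
        linear_combination h - (Real.sin (α / 2) : ℂ) ^ 2 * Complex.I_sq
    · simp [Matrix.det_fin_two, -Complex.ofReal_cos, -Complex.ofReal_sin]
      linear_combination h - (Real.sin (α / 2) : ℂ) ^ 2 * Complex.I_sq⟩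

/-- The real rotation matrix of angle `β/2`, as an element of `SU(2)`. -/
def su2Y (β : ℝ) : SU2 :=
  ⟨!![(Real.cos (β / 2) : ℂ), -(Real.sin (β / 2) : ℂ);
      (Real.sin (β / 2) : ℂ), (Real.cos (β / 2) : ℂ)], by
    have h : (Real.cos (β / 2) : ℂ) ^ 2 + (Real.sin (β / 2) : ℂ) ^ 2 = 1 := by
      exact_mod_cast Real.cos_sq_add_sin_sq (β / 2)
    rw [Matrix.mem_specialUnitaryGroup_iff, Matrix.mem_unitaryGroup_iff]
    constructor
    · ext i j
      fin_cases i <;> fin_cases j <;>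
        simp [Matrix.mul_apply, Fin.sum_univ_two, Matrix.star_apply, -Complex.ofReal_cos,
          -Complex.ofReal_sin] <;>
        first | linear_combination h | ring
    · simp [Matrix.det_fin_two, -Complex.ofReal_cos, -Complex.ofReal_sin]
      linear_combination h⟩

/-- The rotation by `α` around the `z` axis. -/
def rotZ (α : ℝ) : SO3 :=
  ⟨!![Real.cos α, -Real.sin α, 0; Real.sin α, Real.cos α, 0; 0, 0, 1], by
    have h := Real.cos_sq_add_sin_sq α
    rw [Matrix.mem_specialOrthogonalGroup_iff, Matrix.mem_orthogonalGroup_iff]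
    constructor
    · ext i j
      fin_cases i <;> fin_cases j <;>
        simp [Matrix.mul_apply, Fin.sum_univ_three] <;>
        first | linear_combination h | ring
    · simp [Matrix.det_fin_three]
      linear_combination h⟩

/-- The rotation by `β` around the `y` axis. -/
def rotY (β : ℝ) : SO3 :=
  ⟨!![Real.cos β, 0, Real.sin β; 0, 1, 0; -Real.sin β, 0, Real.cos β], by
    have h := Real.cos_sq_add_sin_sq β
    rw [Matrix.mem_specialOrthogonalGroup_iff, Matrix.mem_orthogonalGroup_iff]
    constructor
    · ext i j
      fin_cases i <;> fin_cases j <;>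
        simp [Matrix.mul_apply, Fin.sum_univ_three] <;>
        first | linear_combination h | ring
    · simp [Matrix.det_fin_three]
      linear_combination h⟩

lemma covers_Z (α : ℝ) : Covers (su2Z α) (rotZ α) := by
  intro x
  have hc : Real.cos α = Real.cos (α / 2) ^ 2 - Real.sin (α / 2) ^ 2 := by
    rw [← Real.cos_two_mul']; congr 1; ring
  have hs : Real.sin α = 2 * Real.sin (α / 2) * Real.cos (α / 2) := by
    rw [← Real.sin_two_mul]; congr 1; ring
  have h : (Real.cos (α / 2) : ℂ) ^ 2 + (Real.sin (α / 2) : ℂ) ^ 2 = 1 := by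
    exact_mod_cast Real.cos_sq_add_sin_sq (α / 2)
  have hI : Complex.I ^ 2 = -1 := Complex.I_sq
  dsimp only [rotZ, su2Z]
  rw [hc, hs]
  generalize Real.cos (α / 2) = c at *
  generalize Real.sin (α / 2) = s at *
  ext i j
  fin_cases i <;> fin_cases j <;>
    simp [pauli, Matrix.mul_apply, Fin.sum_univ_two, Matrix.mulVec, dotProduct,
      Fin.sum_univ_three] <;>
    grind

lemma covers_Y (β : ℝ) : Covers (su2Y β) (rotY β) := by
  intro x
  have hc : Real.cos β = Real.cos (β / 2) ^ 2 - Real.sin (β / 2) ^ 2 := by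
    rw [← Real.cos_two_mul']; congr 1; ring
  have hs : Real.sin β = 2 * Real.sin (β / 2) * Real.cos (β / 2) := by
    rw [← Real.sin_two_mul]; congr 1; ring
  have h : (Real.cos (β / 2) : ℂ) ^ 2 + (Real.sin (β / 2) : ℂ) ^ 2 = 1 := by
    exact_mod_cast Real.cos_sq_add_sin_sq (β / 2)
  dsimp only [rotY, su2Y]
  rw [hc, hs]
  generalize Real.cos (β / 2) = c at *
  generalize Real.sin (β / 2) = s at *
  ext i j
  fin_cases i <;> fin_cases j <;>
    simp [pauli, Matrix.mul_apply, Fin.sum_univ_two, Matrix.mulVec, dotProduct,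
      Fin.sum_univ_three] <;>
    grind

/-- A pair of reals is of the form `r (cos θ, sin θ)` with `r ≥ 0`. -/
lemma exists_polar (a b : ℝ) : ∃ r θ : ℝ, 0 ≤ r ∧ a = r * Real.cos θ ∧ b = r * Real.sin θ := by
  refine ⟨‖(⟨a, b⟩ : ℂ)‖, Complex.arg ⟨a, b⟩, norm_nonneg _, ?_, ?_⟩
  · simp [Complex.norm_mul_cos_arg]
  · simp [Complex.norm_mul_sin_arg]

lemma SO3.transpose_mul (u : SO3) : u.1.transpose * u.1 = 1 :=
  (Matrix.mem_orthogonalGroup_iff' (Fin 3) ℝ).mp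
    (Matrix.mem_specialOrthogonalGroup_iff.mp u.2).1

lemma SO3.mul_transpose (u : SO3) : u.1 * u.1.transpose = 1 :=
  (Matrix.mem_orthogonalGroup_iff (Fin 3) ℝ).mp
    (Matrix.mem_specialOrthogonalGroup_iff.mp u.2).1

/-- ZYZ Euler angles. -/
lemma exists_euler (u : SO3) : ∃ α β γ : ℝ, u = rotZ α * rotY β * rotZ γ := by
  obtain ⟨r, α, hr, h0, h1⟩ := exists_polar (u.1 0 2) (u.1 1 2)
  obtain ⟨r', β, hr', h2, h3⟩ := exists_polar (u.1 2 2) r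
  have hcol : u.1 0 2 ^ 2 + u.1 1 2 ^ 2 + u.1 2 2 ^ 2 = 1 := by
    have := congrFun (congrFun u.transpose_mul 2) 2
    simp [Matrix.mul_apply, Fin.sum_univ_three] at this
    linarith
  have hr1 : r' = 1 := by
    have e1 := Real.cos_sq_add_sin_sq α
    have e2 := Real.cos_sq_add_sin_sq β
    have : r' ^ 2 = 1 := by
      have : r ^ 2 + u.1 2 2 ^ 2 = 1 := by rw [← hcol, h0, h1]; linear_combination (-r ^ 2) * e1
      rw [h2, h3] at this
      linear_combination this - r' ^ 2 * e2
    exact (pow_eq_one_iff_of_nonneg hr' two_ne_zero).mp this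
  subst hr1
  rw [one_mul] at h2 h3
  -- the remaining rotation fixes the `z` axis
  obtain ⟨v, hv⟩ : ∃ v : SO3, v = (rotZ α * rotY β)⁻¹ * u := ⟨_, rfl⟩
  have hu : u = rotZ α * rotY β * v := by rw [hv]; group
  have hvm : v.1 = (rotY β).1.transpose * ((rotZ α).1.transpose * u.1) := by
    rw [hv, mul_inv_rev]
    change (star (rotY β).1 * star (rotZ α).1) * u.1 = _
    rw [Matrix.mul_assoc]; rfl
  have e1 := Real.cos_sq_add_sin_sq α
  have e2 := Real.cos_sq_add_sin_sq β
  have v02 : v.1 0 2 = 0 := by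
    rw [hvm]
    simp [Matrix.mul_apply, Fin.sum_univ_three, rotY, rotZ, h0, h1, h2, h3]
    linear_combination (Real.cos β * Real.sin β) * e1
  have v12 : v.1 1 2 = 0 := by
    rw [hvm]
    simp [Matrix.mul_apply, Fin.sum_univ_three, rotY, rotZ, h0, h1, h2, h3]
    ring
  have v22 : v.1 2 2 = 1 := by
    rw [hvm]
    simp [Matrix.mul_apply, Fin.sum_univ_three, rotY, rotZ, h0, h1, h2, h3]
    linear_combination (Real.sin β ^ 2) * e1 + e2
  have hvt (i j : Fin 3) := congrFun (congrFun v.transpose_mul i) j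
  have hvt' (i j : Fin 3) := congrFun (congrFun v.mul_transpose i) j
  have hdet : v.1.det = 1 := (Matrix.mem_specialOrthogonalGroup_iff.mp v.2).2
  have r2 := hvt' 2 2
  have c0 := hvt 0 0
  have c01 := hvt 0 1
  have c1 := hvt 1 1
  simp [Matrix.mul_apply, Fin.sum_univ_three, v22] at r2 c0 c01 c1
  have v20 : v.1 2 0 = 0 :=
    mul_self_eq_zero.mp (by linarith [mul_self_nonneg (v.1 2 0), mul_self_nonneg (v.1 2 1)])
  have v21 : v.1 2 1 = 0 :=
    mul_self_eq_zero.mp (by linarith [mul_self_nonneg (v.1 2 0), mul_self_nonneg (v.1 2 1)])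
  rw [Matrix.det_fin_three] at hdet
  rw [v20, v21] at c01
  rw [v20] at c0
  rw [v21] at c1
  rw [v02, v12, v22, v20, v21] at hdet
  obtain ⟨s, γ, hs, g0, g1⟩ := exists_polar (v.1 0 0) (v.1 1 0)
  have hs1 : s = 1 := by
    have e3 := Real.cos_sq_add_sin_sq γ
    rw [g0, g1] at c0
    have : s ^ 2 = 1 := by linear_combination c0 - s ^ 2 * e3
    exact (pow_eq_one_iff_of_nonneg hs two_ne_zero).mp this
  subst hs1
  rw [one_mul] at g0 g1
  have e3 := Real.cos_sq_add_sin_sq γ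
  rw [g0, g1] at c01 hdet
  have v01 : v.1 0 1 = -Real.sin γ := by
    linear_combination (-v.1 0 1) * e3 + Real.cos γ * c01 - Real.sin γ * hdet
  have v11 : v.1 1 1 = Real.cos γ := by
    linear_combination (-v.1 1 1) * e3 + Real.sin γ * c01 + Real.cos γ * hdet
  refine ⟨α, β, γ, ?_⟩
  rw [hu]
  congr 1
  apply Subtype.ext
  ext i j
  fin_cases i <;> fin_cases j <;> simp [rotZ, v02, v12, v22, v20, v21, g0, g1, v01, v11]

/-- The double cover is onto. -/
lemma exists_covers (u : SO3) : ∃ g : SU2, Covers g u := by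
  obtain ⟨α, β, γ, rfl⟩ := exists_euler u
  exact ⟨_, ((covers_Z α).mul (covers_Y β)).mul (covers_Z γ)⟩

/-- One of the two elements `±g` of `SU(2)` over a rotation `u`. -/
def coverLift (u : SO3) : SU2 := (exists_covers u).choose

lemma covers_coverLift (u : SO3) : Covers (coverLift u) u := (exists_covers u).choose_spec

/-- Two elements of `SU(2)` over the same rotation differ at most by a sign. -/
lemma Covers.eq_or_eq_neg {g h : SU2} {u : SO3} (hg : Covers g u) (hh : Covers h u) :
    g.1 = h.1 ∨ g.1 = -h.1 := by
  have hgu : g.1.conjTranspose * g.1 = 1 :=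
    Matrix.mem_unitaryGroup_iff'.mp (Matrix.mem_specialUnitaryGroup_iff.mp g.2).1
  have hhu : h.1.conjTranspose * h.1 = 1 :=
    Matrix.mem_unitaryGroup_iff'.mp (Matrix.mem_specialUnitaryGroup_iff.mp h.2).1
  have hhu' : h.1 * h.1.conjTranspose = 1 :=
    Matrix.mem_unitaryGroup_iff.mp (Matrix.mem_specialUnitaryGroup_iff.mp h.2).1
  obtain ⟨K, hK⟩ : ∃ K, K = h.1.conjTranspose * g.1 := ⟨_, rfl⟩
  have hgK : g.1 = h.1 * K := by rw [hK, ← Matrix.mul_assoc, hhu', one_mul]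
  have hdet : K.det = 1 := by
    have := (Matrix.mem_specialUnitaryGroup_iff.mp g.2).2
    rwa [hgK, Matrix.det_mul, (Matrix.mem_specialUnitaryGroup_iff.mp h.2).2, one_mul] at this
  have hcomm (x : Fin 3 → ℝ) : K * pauli x = pauli x * K := by
    have h1 : g.1 * pauli x * g.1.conjTranspose = h.1 * pauli x * h.1.conjTranspose := by
      rw [← hg x, hh x]
    calc K * pauli x = h.1.conjTranspose * (g.1 * pauli x * g.1.conjTranspose) * g.1 := by
          rw [hK]; simp only [Matrix.mul_assoc, hgu, mul_one]
      _ = (h.1.conjTranspose * h.1) * pauli x * (h.1.conjTranspose * g.1) := by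
          rw [h1]; simp only [Matrix.mul_assoc]
      _ = pauli x * K := by rw [hhu, one_mul, hK]
  have z := hcomm ![0, 0, 1]
  have y := hcomm ![1, 0, 0]
  have z01 := congrFun (congrFun z 0) 1
  have z10 := congrFun (congrFun z 1) 0
  have y01 := congrFun (congrFun y 0) 1
  simp [pauli, Matrix.mul_apply, Fin.sum_univ_two] at z01 z10 y01
  have k01 : K 0 1 = 0 := by linear_combination (-1 / 2) * z01
  have k10 : K 1 0 = 0 := by linear_combination (1 / 2) * z10
  rw [Matrix.det_fin_two, k01, ← y01] at hdet
  have hsq : K 0 0 = 1 ∨ K 0 0 = -1 := by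
    exact mul_self_eq_one_iff.mp (by linear_combination hdet)
  rcases hsq with hk | hk
  · left
    have : K = 1 := by
      ext i j
      fin_cases i <;> fin_cases j <;> simp [k01, k10, hk, ← y01]
    rw [hgK, this, mul_one]
  · right
    have : K = -1 := by
      ext i j
      fin_cases i <;> fin_cases j <;> simp [k01, k10, hk, ← y01]
    rw [hgK, this, mul_neg, mul_one]

/-! ## Irreducible representations and their matrix elements -/

/-- The representation `ρ_ℓ` of `SL(2, ℂ)` on polynomials `Q` of degree at most `2ℓ`:
`(ρ_ℓ(g) Q)(x) = (-b x + a)^{2ℓ} Q((d x - c) / (-b x + a))` for `g = !![a, c; b, d]`, expanded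
over the monomials of `Q`. -/
def polyRep (ℓ : ℕ) (g : Matrix (Fin 2) (Fin 2) ℂ) (Q : Polynomial ℂ) : Polynomial ℂ :=
  ∑ k ∈ Finset.range (2 * ℓ + 1),
    Polynomial.C (Q.coeff k) *
      (Polynomial.C (g 1 1) * Polynomial.X - Polynomial.C (g 0 1)) ^ k *
      (Polynomial.C (g 0 0) - Polynomial.C (g 1 0) * Polynomial.X) ^ (2 * ℓ - k)

/-- The invariant inner product on polynomials of degree at most `2ℓ` (linear in the first
argument): the monomials are orthogonal and `⟨x^{ℓ-m}, x^{ℓ-m}⟩ = (ℓ-m)! (ℓ+m)!`. -/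
def polyInner (ℓ : ℕ) (P Q : Polynomial ℂ) : ℂ :=
  ∑ k ∈ Finset.range (2 * ℓ + 1),
    P.coeff k * conj (Q.coeff k) * ((k.factorial * (2 * ℓ - k).factorial : ℕ) : ℂ)

/-- The orthonormal basis `ψ_m = ε^m x^{ℓ-m} / √((ℓ-m)! (ℓ+m)!)`, `-ℓ ≤ m ≤ ℓ`, with phase
convention `ε ∈ {1, -1}`. -/
def psi (ε : ℝ) (ℓ : ℕ) (m : ℤ) : Polynomial ℂ :=
  Polynomial.C
      ((ε ^ m / √((((ℓ : ℤ) - m).toNat.factorial * ((ℓ : ℤ) + m).toNat.factorial : ℕ) : ℝ) : ℝ) : ℂ)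
    * Polynomial.X ^ ((ℓ : ℤ) - m).toNat

/-- The matrix elements `ρ_ℓ^{mn}(g) = ⟨ρ_ℓ(g) ψ_n, ψ_m⟩` on `SU(2)`. -/
def matrixElementSU2 (ε : ℝ) (ℓ : ℕ) (m n : ℤ) (g : SU2) : ℂ :=
  polyInner ℓ (polyRep ℓ g.1 (psi ε ℓ n)) (psi ε ℓ m)

/-- The matrix elements `ρ_ℓ^{mn}(u)` (Wigner `D`) on `SO(3)`, for integer `ℓ`; since
`ρ_ℓ(-g) = ρ_ℓ(g)`, they do not depend on the chosen `g ∈ SU(2)` over `u`. -/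
def wignerD (ε : ℝ) (ℓ : ℕ) (m n : ℤ) (u : SO3) : ℂ :=
  matrixElementSU2 ε ℓ m n (coverLift u)

lemma polyRep_neg (ℓ : ℕ) (g : Matrix (Fin 2) (Fin 2) ℂ) (Q : Polynomial ℂ) :
    polyRep ℓ (-g) Q = polyRep ℓ g Q := by
  refine Finset.sum_congr rfl fun k hk => ?_
  have hk' : k + (2 * ℓ - k) = 2 * ℓ := by have := Finset.mem_range.mp hk; omega
  have h1 : (-1 : Polynomial ℂ) ^ k * (-1) ^ (2 * ℓ - k) = 1 := by
    rw [← pow_add, hk', pow_mul]; simp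
  have e1 : Polynomial.C ((-g) 1 1) * Polynomial.X - Polynomial.C ((-g) 0 1) =
      -1 * (Polynomial.C (g 1 1) * Polynomial.X - Polynomial.C (g 0 1)) := by
    simp only [Matrix.neg_apply, Polynomial.C_neg]; ring
  have e2 : Polynomial.C ((-g) 0 0) - Polynomial.C ((-g) 1 0) * Polynomial.X =
      -1 * (Polynomial.C (g 0 0) - Polynomial.C (g 1 0) * Polynomial.X) := by
    simp only [Matrix.neg_apply, Polynomial.C_neg]; ring
  rw [e1, e2, mul_pow, mul_pow]
  linear_combination (Polynomial.C (Q.coeff k) *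
    (Polynomial.C (g 1 1) * Polynomial.X - Polynomial.C (g 0 1)) ^ k *
    (Polynomial.C (g 0 0) - Polynomial.C (g 1 0) * Polynomial.X) ^ (2 * ℓ - k)) * h1

lemma wignerD_eq_of_covers (ε : ℝ) (ℓ : ℕ) (m n : ℤ) {g : SU2} {u : SO3} (hg : Covers g u) :
    wignerD ε ℓ m n u = matrixElementSU2 ε ℓ m n g := by
  rw [wignerD, matrixElementSU2, matrixElementSU2]
  rcases (covers_coverLift u).eq_or_eq_neg hg with h | h
  · rw [h]
  · rw [h, polyRep_neg]

/-! ## Spherical harmonics -/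

/-- The associated Legendre function
`(-1)^ℓ ε^m / (2^ℓ ℓ!) (1 - x²)^{m/2} d^{ℓ+m}/dx^{ℓ+m} (1 - x²)^ℓ` on `[-1, 1]`, for
`-ℓ ≤ m ≤ ℓ`. The Condon–Shortley phase is present for `ε = -1` and absent for `ε = 1`.
(At `x = ±1` and `m < 0` Lean's `0 ^ m = 0` is the continuous extension.) -/
def assocLegendre (ε : ℝ) (ℓ : ℕ) (m : ℤ) (x : ℝ) : ℝ :=
  (-1) ^ ℓ * ε ^ m / (2 ^ ℓ * ℓ.factorial) * √(1 - x ^ 2) ^ m *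
    (Polynomial.derivative^[((ℓ : ℤ) + m).toNat]
      ((1 - Polynomial.X ^ 2 : Polynomial ℝ) ^ ℓ)).eval x

/-- `Y_m^ℓ(θ, φ)`, with `θ` the polar and `φ` the azimuthal angle. -/
def sphHarmAngle (ε : ℝ) (ℓ : ℕ) (m : ℤ) (θ φ : ℝ) : ℂ :=
  ((√((2 * ℓ + 1) / (4 * Real.pi) *
      (((ℓ : ℤ) - m).toNat.factorial / ((ℓ : ℤ) + m).toNat.factorial)) *
    assocLegendre ε ℓ m (Real.cos θ) : ℝ) : ℂ) * Complex.exp (Complex.I * m * φ)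

/-- `Y_m^ℓ` as a function on `S²`, where
`x = (sin θ cos φ, sin θ sin φ, cos θ)`. -/
def sphHarm (ε : ℝ) (ℓ : ℕ) (m : ℤ) (x : S2) : ℂ :=
  sphHarmAngle ε ℓ m (Real.arccos (x.1 2)) (Complex.arg ⟨x.1 0, x.1 1⟩)

/-- The spherical harmonic coefficient `∫_{S²} f(x) conj(Y_m^ℓ(x)) dx`. -/
def sphCoeff (ε : ℝ) (f : S2 → ℂ) (ℓ : ℕ) (m : ℤ) : ℂ :=
  ∫ x, f x * conj (sphHarm ε ℓ m x) ∂areaS2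

end

/-! ## The orbit map of the north pole and the invariant measures -/

/-! The orbit map `u ↦ uν` carries Haar measure to `2π` times the area of the sphere
(`map_orbitMap_haarSO3`), and its fibres are the cosets of the rotations around the `z` axis.
Replacing `u` by `u Z(γ)` leaves `f(uν)` unchanged and multiplies `ρ_ℓ^{mn}(u⁻¹)` by `e^{imγ}`
(`wignerD_rotZ_mul`). If `m ≠ 0`, the choice `γ = π/m` shows that the integral is its own negative.
If `m = 0`, the matrix element descends to the sphere, where it is `√(4π/(2ℓ+1)) Y_n^ℓ`
(`wignerD_zero_inv`); the formula is then a change of variables. That identification reduces, by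
equivariance on both sides, to rotations around the `y` axis (`wignerD_zero_rotY`). There Rodrigues'
formula in the half angle gives one coefficient of a product of linear forms, the matrix element
gives another, and `choose_mul_coeff_symm` relates the two. Absolute convergence holds because `L² ⊂
L¹` for a finite measure and the other factor is continuous on a compact space. -/

instance instCompactSpaceSU2 : CompactSpace SU2 := by
  refine isCompact_iff_compactSpace.mp
    (IsCompact.of_isClosed_subset (isCompact_univ_pi fun _ : Fin 2 =>
      isCompact_univ_pi fun _ : Fin 2 => isCompact_closedBall (0 : ℂ) 1) ?_ ?_)
  · have h : ((Matrix.specialUnitaryGroup (Fin 2) ℂ : Submonoid _) :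
        Set (Matrix (Fin 2) (Fin 2) ℂ)) = {A | A * star A = 1} ∩ {A | A.det = 1} := by
      ext A
      simp [Matrix.mem_specialUnitaryGroup_iff, Matrix.mem_unitaryGroup_iff]
    exact h ▸ (isClosed_eq (by fun_prop) continuous_const).inter
      (isClosed_eq (by fun_prop) continuous_const)
  · intro A hA i _ j _
    exact mem_closedBall_zero_iff.mpr
      (entry_norm_bound_of_unitary (Matrix.mem_specialUnitaryGroup_iff.mp hA).1 i j)

instance instSecondCountableTopologySO3 : SecondCountableTopology SO3 :=
  haveI : SecondCountableTopology (Matrix (Fin 3) (Fin 3) ℝ) :=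
    inferInstanceAs (SecondCountableTopology (Fin 3 → Fin 3 → ℝ))
  TopologicalSpace.Subtype.secondCountableTopology _

lemma continuous_rotateS2 : Continuous fun p : SO3 × S2 => rotateS2 p.1 p.2 := by
  refine Continuous.subtype_mk ?_ _
  refine (PiLp.continuous_toLp 2 _).comp ?_
  refine Continuous.matrix_mulVec (continuous_subtype_val.comp continuous_fst) ?_
  exact (PiLp.continuous_ofLp 2 _).comp (continuous_subtype_val.comp continuous_snd)

lemma rotateS2_mul (u v : SO3) (x : S2) : rotateS2 (u * v) x = rotateS2 u (rotateS2 v x) := by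
  apply Subtype.ext
  simp [rotateS2, Matrix.mulVec_mulVec]

lemma rotateS2_one (x : S2) : rotateS2 1 x = x := by
  apply Subtype.ext
  simp [rotateS2]

/-- A rotation as a linear isometry of `ℝ³`. -/
noncomputable def rotateIsometry (u : SO3) :
    EuclideanSpace ℝ (Fin 3) ≃ₗᵢ[ℝ] EuclideanSpace ℝ (Fin 3) :=
  LinearIsometry.toLinearIsometryEquiv
    { toFun := fun x => WithLp.toLp 2 (u.1.mulVec x.ofLp)
      map_add' := fun x y => by simp [Matrix.mulVec_add]
      map_smul' := fun c x => by simp [Matrix.mulVec_smul]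
      norm_map' := norm_rotateS2 u } rfl

lemma coe_rotateS2 (u : SO3) (x : S2) : (rotateS2 u x : EuclideanSpace ℝ (Fin 3)) =
    rotateIsometry u x := rfl

open scoped Pointwise in
-- The area of `s` is three times the volume of the open cone over `s`; a linear isometry carries
-- cones to cones and preserves volume.
lemma measurePreserving_rotateS2 (u : SO3) : MeasurePreserving (rotateS2 u) areaS2 areaS2 := by
  have hm : Measurable (rotateS2 u) :=
    (continuous_rotateS2.comp (Continuous.prodMk_right u)).measurable
  refine ⟨hm, Measure.ext fun s hs => ?_⟩
  rw [Measure.map_apply hm hs, areaS2, Measure.toSphere_apply' _ (hm hs),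
    Measure.toSphere_apply' _ hs]
  congr 1
  rw [← (rotateIsometry u).measurePreserving.measure_preimage_emb
    (rotateIsometry u).toHomeomorph.measurableEmbedding (Set.Ioo (0 : ℝ) 1 • (Subtype.val '' s))]
  congr 1
  ext y
  constructor
  · rintro ⟨r, hr, _, ⟨x, hx, rfl⟩, rfl⟩
    exact ⟨r, hr, _, ⟨_, hx, rfl⟩, by simp [coe_rotateS2]⟩
  · rintro ⟨r, hr, _, ⟨x, hx, rfl⟩, h⟩
    have hr' : rotateS2 u (rotateS2 u⁻¹ x) = x := by
      rw [← rotateS2_mul, mul_inv_cancel, rotateS2_one]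
    refine ⟨r, hr, _, ⟨rotateS2 u⁻¹ x, ?_, rfl⟩, (rotateIsometry u).injective ?_⟩
    · rwa [Set.mem_preimage, hr']
    · rw [← h]
      simp only [map_smul]
      rw [← coe_rotateS2 u (rotateS2 u⁻¹ x), hr']

lemma areaS2_univ : areaS2 Set.univ = ENNReal.ofReal (4 * Real.pi) := by
  rw [areaS2, Measure.toSphere_apply_univ, EuclideanSpace.volume_ball_fin_three]
  rw [finrank_euclideanSpace, Fintype.card_fin]
  simp only [ENNReal.ofReal_one, one_pow, one_mul]
  rw [← ENNReal.ofReal_natCast, ← ENNReal.ofReal_mul (by positivity)]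
  congr 1
  push_cast
  ring

instance : IsFiniteMeasure areaS2 := ⟨by rw [areaS2_univ]; exact ENNReal.ofReal_lt_top⟩

lemma haarSO3_univ : haarSO3 Set.univ = ENNReal.ofReal (8 * Real.pi ^ 2) := by
  have h : Measure.haarMeasure (⊤ : TopologicalSpace.PositiveCompacts SO3) Set.univ = 1 :=
    Measure.haarMeasure_self
  rw [haarSO3, Measure.smul_apply, h, smul_eq_mul, mul_one]

instance : IsFiniteMeasure haarSO3 := ⟨by rw [haarSO3_univ]; exact ENNReal.ofReal_lt_top⟩

instance : haarSO3.IsMulRightInvariant := by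
  set μ : Measure SO3 := Measure.haarMeasure ⊤ with hμ
  have hprob : IsProbabilityMeasure μ := ⟨Measure.haarMeasure_self⟩
  have : μ.IsMulRightInvariant := ⟨fun g => by
    -- A right translate of `μ` is still left invariant, so by uniqueness it is a multiple of `μ`;
    -- comparing total masses shows that the multiple is `1`.
    have hp : IsProbabilityMeasure (μ.map (· * g)) :=
      Measure.isProbabilityMeasure_map (by fun_prop)
    have h := Measure.isMulInvariant_eq_smul_of_compactSpace (μ.map (· * g)) μ
    have h1 := congrArg (fun ν : Measure SO3 => ν Set.univ) h
    simp only [measure_univ, Measure.smul_apply] at h1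
    rw [h]
    ext s
    rw [Measure.smul_apply]
    rw [ENNReal.smul_def, smul_eq_mul, mul_one] at h1
    rw [ENNReal.smul_def, ← h1, one_smul]⟩
  exact isMulRightInvariant_smul _

/-- The orbit map `u ↦ uν` of the north pole. -/
noncomputable def orbitMap (u : SO3) : S2 := rotateS2 u northPole

lemma continuous_orbitMap : Continuous orbitMap :=
  continuous_rotateS2.comp (Continuous.prodMk_left northPole)

lemma orbitMap_eq (u : SO3) : (orbitMap u : EuclideanSpace ℝ (Fin 3)) =
    !₂[u.1 0 2, u.1 1 2, u.1 2 2] := by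
  ext i
  fin_cases i <;> simp [orbitMap, rotateS2, northPole, Matrix.mulVec, dotProduct,
    Fin.sum_univ_three]

/-- The rotation `Z(φ) Y(θ)` that takes the north pole to the point with polar angle `θ` and
azimuthal angle `φ`. -/
noncomputable def sphereSection (x : S2) : SO3 :=
  rotZ (Complex.arg ⟨x.1 0, x.1 1⟩) * rotY (Real.arccos (x.1 2))

lemma S2_sum_sq (x : S2) : x.1 0 ^ 2 + x.1 1 ^ 2 + x.1 2 ^ 2 = 1 := by
  have h := EuclideanSpace.real_norm_sq_eq x.1
  rw [mem_sphere_zero_iff_norm.mp x.2, Fin.sum_univ_three] at h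
  linarith

lemma orbitMap_sphereSection (x : S2) : orbitMap (sphereSection x) = x := by
  have hx := S2_sum_sq x
  have h1 : Real.cos (Real.arccos (x.1 2)) = x.1 2 :=
    Real.cos_arccos (by nlinarith [sq_nonneg (x.1 0), sq_nonneg (x.1 1)])
      (by nlinarith [sq_nonneg (x.1 0), sq_nonneg (x.1 1)])
  have h2 : Real.sin (Real.arccos (x.1 2)) = ‖(⟨x.1 0, x.1 1⟩ : ℂ)‖ := by
    rw [Real.sin_arccos, Complex.norm_def, Complex.normSq_mk]
    congr 1
    linarith
  apply Subtype.ext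
  rw [orbitMap_eq]
  ext i
  fin_cases i
  · simp [sphereSection, rotZ, rotY, h2]
    rw [mul_comm, Complex.norm_mul_cos_arg]
  · simp [sphereSection, rotZ, rotY, h2]
    rw [mul_comm, Complex.norm_mul_sin_arg]
  · simp [sphereSection, rotZ, rotY, h1]

lemma surjective_orbitMap : Function.Surjective orbitMap :=
  fun x => ⟨_, orbitMap_sphereSection x⟩

/-- The Haar measure of `SO(3)` pushes forward to `2π` times the area of `S²`. -/
lemma map_orbitMap_haarSO3 : haarSO3.map orbitMap = ENNReal.ofReal (2 * Real.pi) • areaS2 := by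
  refine Measure.ext_of_lintegral _ fun h hh => ?_
  rw [lintegral_map hh continuous_orbitMap.measurable, lintegral_smul_measure]
  have hmeas : Measurable fun p : SO3 × S2 => h (rotateS2 p.1 p.2) :=
    hh.comp continuous_rotateS2.measurable
  -- Tonelli for `h(ux)` on `SO(3) × S²`: integrating over `x` first uses rotation invariance of the
  -- area, integrating over `u` first uses right invariance of Haar measure. Dividing the two values
  -- by `4π` gives the claim.
  have h1 : ∫⁻ u, ∫⁻ x, h (rotateS2 u x) ∂areaS2 ∂haarSO3 =
      (∫⁻ x, h x ∂areaS2) * ENNReal.ofReal (8 * Real.pi ^ 2) := by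
    simp_rw [fun u => (measurePreserving_rotateS2 u).lintegral_comp hh]
    rw [lintegral_const, haarSO3_univ]
  have h2 : ∫⁻ x, ∫⁻ u, h (rotateS2 u x) ∂haarSO3 ∂areaS2 =
      (∫⁻ u, h (orbitMap u) ∂haarSO3) * ENNReal.ofReal (4 * Real.pi) := by
    -- Write `x = sν`; the right translation `u ↦ us` removes the dependence on `x`.
    have key (x : S2) : ∫⁻ u, h (rotateS2 u x) ∂haarSO3 = ∫⁻ u, h (orbitMap u) ∂haarSO3 := by
      rw [← lintegral_mul_right_eq_self (fun u => h (orbitMap u)) (sphereSection x)]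
      refine lintegral_congr fun u => ?_
      conv_lhs => rw [← orbitMap_sphereSection x]
      rw [orbitMap, orbitMap, rotateS2_mul]
    simp_rw [key]
    rw [lintegral_const, areaS2_univ]
  have h3 := (h1.symm.trans (lintegral_lintegral_swap hmeas.aemeasurable)).trans h2
  have h4 : ENNReal.ofReal (8 * Real.pi ^ 2) =
      ENNReal.ofReal (2 * Real.pi) * ENNReal.ofReal (4 * Real.pi) := by
    rw [← ENNReal.ofReal_mul (by positivity)]
    congr 1
    ring
  rw [h4, ← mul_assoc] at h3
  have h5 : ENNReal.ofReal (4 * Real.pi) ≠ 0 := by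
    simp [Real.pi_pos]
  rw [← (ENNReal.mul_left_inj h5 ENNReal.ofReal_ne_top).mp h3, smul_eq_mul, mul_comm]

/-! ## Continuity of the matrix elements -/

/-- Continuity of a polynomial-valued map is expressed coefficient by coefficient. -/
lemma continuous_coeff_mul {α R : Type*} [TopologicalSpace α] [Semiring R] [TopologicalSpace R]
    [IsTopologicalSemiring R] {F G : α → Polynomial R}
    (hF : ∀ k, Continuous fun x => (F x).coeff k) (hG : ∀ k, Continuous fun x => (G x).coeff k)
    (k : ℕ) : Continuous fun x => (F x * G x).coeff k := by
  simp_rw [Polynomial.coeff_mul]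
  exact continuous_finsetSum _ fun p _ => (hF p.1).mul (hG p.2)

lemma continuous_coeff_pow {α R : Type*} [TopologicalSpace α] [Semiring R] [TopologicalSpace R]
    [IsTopologicalSemiring R] {F : α → Polynomial R}
    (hF : ∀ k, Continuous fun x => (F x).coeff k) (n k : ℕ) :
    Continuous fun x => (F x ^ n).coeff k := by
  induction n generalizing k with
  | zero => simpa using continuous_const
  | succ n ih =>
    simp_rw [pow_succ]
    exact continuous_coeff_mul ih hF k

lemma continuous_matrixElementSU2 (ε : ℝ) (ℓ : ℕ) (m n : ℤ) :
    Continuous (matrixElementSU2 ε ℓ m n) := by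
  have hent (i j : Fin 2) : Continuous fun g : SU2 => g.1 i j :=
    continuous_subtype_val.matrix_elem i j
  have hlin (i j i' j' : Fin 2) (k : ℕ) : Continuous fun g : SU2 =>
      (Polynomial.C (g.1 i j) * Polynomial.X - Polynomial.C (g.1 i' j')).coeff k := by
    simp only [Polynomial.coeff_sub, Polynomial.coeff_C_mul, Polynomial.coeff_C]
    refine ((hent i j).mul continuous_const).sub ?_
    split_ifs
    exacts [hent i' j', continuous_const]
  have hlin' (i j i' j' : Fin 2) (k : ℕ) : Continuous fun g : SU2 =>
      (Polynomial.C (g.1 i' j') - Polynomial.C (g.1 i j) * Polynomial.X).coeff k := by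
    simp_rw [← neg_sub (Polynomial.C (_ : ℂ) * Polynomial.X), Polynomial.coeff_neg]
    exact (hlin i j i' j' k).neg
  unfold matrixElementSU2 polyInner
  refine continuous_finsetSum _ fun k _ => (Continuous.mul ?_ continuous_const).mul continuous_const
  simp only [polyRep, Polynomial.finsetSum_coeff]
  refine continuous_finsetSum _ fun i _ => ?_
  exact continuous_coeff_mul (continuous_coeff_mul (fun _ => continuous_const)
    (continuous_coeff_pow (hlin 1 1 0 1) i)) (continuous_coeff_pow (hlin' 1 0 0 0) _) k

lemma isClosed_covers : IsClosed {p : SU2 × SO3 | Covers p.1 p.2} := by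
  have : {p : SU2 × SO3 | Covers p.1 p.2} = ⋂ x : Fin 3 → ℝ,
      {p | pauli (p.2.1.mulVec x) = p.1.1 * pauli x * p.1.1.conjTranspose} := by
    ext p; simp [Covers]
  rw [this]
  refine isClosed_iInter fun x => isClosed_eq ?_ (by fun_prop)
  have hc (i : Fin 3) : Continuous fun p : SU2 × SO3 => ((p.2.1.mulVec x i : ℝ) : ℂ) :=
    Complex.continuous_ofReal.comp ((continuous_apply i).comp
      (Continuous.matrix_mulVec (continuous_subtype_val.comp continuous_snd) continuous_const))
  refine continuous_matrix fun i j => ?_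
  have h0 := hc 0
  have h1 := hc 1
  have h2 := hc 2
  fin_cases i <;> fin_cases j <;> simp only [pauli] <;> simp <;> fun_prop

/-- The lift `coverLift` is an arbitrary choice and need not be continuous. Since the value is the
same for every lift, the preimage of a closed set is the projection of a closed subset of the
compact space `SU(2) × SO(3)`, hence closed. -/
lemma continuous_wignerD (ε : ℝ) (ℓ : ℕ) (m n : ℤ) : Continuous (wignerD ε ℓ m n) := by
  refine continuous_iff_isClosed.mpr fun C hC => ?_
  have h : wignerD ε ℓ m n ⁻¹' C = Prod.snd ''
      ({p : SU2 × SO3 | Covers p.1 p.2} ∩ {p | matrixElementSU2 ε ℓ m n p.1 ∈ C}) := by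
    ext u
    constructor
    · intro hu
      exact ⟨(coverLift u, u), ⟨covers_coverLift u, hu⟩, rfl⟩
    · rintro ⟨⟨g, v⟩, ⟨hg, hgC⟩, rfl⟩
      change wignerD ε ℓ m n v ∈ C
      rwa [wignerD_eq_of_covers ε ℓ m n hg]
  rw [h]
  exact ((isClosed_covers.inter (hC.preimage
    ((continuous_matrixElementSU2 ε ℓ m n).comp continuous_fst))).isCompact.image
    continuous_snd).isClosed

/-! ## Explicit matrix elements and spherical harmonics -/

lemma Polynomial.coeff_C_mul_X_add_C_pow {R : Type*} [CommSemiring R] (a b : R) (N i : ℕ) :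
    ((C a * X + C b) ^ N).coeff i = a ^ i * b ^ (N - i) * N.choose i := by
  rw [add_pow, finsetSum_coeff]
  have h (k : ℕ) : (((C a * X) ^ k * C b ^ (N - k) * (N.choose k : Polynomial R)).coeff i) =
      if i = k then a ^ i * b ^ (N - i) * N.choose i else 0 := by
    have : (C a * X) ^ k * C b ^ (N - k) * (N.choose k : Polynomial R) =
        C (a ^ k * b ^ (N - k) * N.choose k) * X ^ k := by
      simp only [C_mul, C_pow, map_natCast]
      ring
    rw [this, coeff_C_mul_X_pow]
    split_ifs with hik
    · rw [hik]
    · rfl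
  simp_rw [h]
  rw [Finset.sum_ite_eq]
  split_ifs with hi
  · rfl
  · rw [Nat.choose_eq_zero_of_lt (by simpa using hi)]
    simp

open Polynomial in
/-- The symmetry of the matrix coefficients of a substitution acting on binary forms. -/
lemma choose_mul_coeff_symm (p q r s : ℝ) {N i j : ℕ} (hj : j ≤ N) :
    (N.choose j : ℝ) * ((Polynomial.C p * Polynomial.X + Polynomial.C q) ^ (N - j) *
      (Polynomial.C r * Polynomial.X + Polynomial.C s) ^ j).coeff i =
    (N.choose i : ℝ) * ((Polynomial.C r * Polynomial.X + Polynomial.C p) ^ i *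
      (Polynomial.C s * Polynomial.X + Polynomial.C q) ^ (N - i)).coeff j := by
  -- Both sides, as polynomials in `y`, are the coefficient of `x^i` in `(y(rx + s) + (px + q))^N`:
  -- the left by expanding in powers of `y`, the right by regrouping the form as `(ry + p)x + (sy +
  -- q)`.
  have key : ∑ k ∈ Finset.range (N + 1),
      C ((N.choose k : ℝ) * ((C p * X + C q) ^ (N - k) * (C r * X + C s) ^ k).coeff i) * X ^ k =
      C (N.choose i : ℝ) * ((C r * X + C p) ^ i * (C s * X + C q) ^ (N - i)) := by
    refine Polynomial.funext fun y => ?_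
    have h1 : C (y * r + p) * X + C (y * s + q) =
        C y * (C r * X + C s) + (C p * X + C q) := by
      simp only [C_add, C_mul]; ring
    have h2 := coeff_C_mul_X_add_C_pow (y * r + p) (y * s + q) N i
    rw [h1, add_pow, finsetSum_coeff] at h2
    rw [eval_finsetSum]
    simp only [eval_mul, eval_pow, eval_C, eval_X, eval_add]
    rw [mul_comm r y, mul_comm s y, mul_comm (N.choose i : ℝ), ← h2]
    refine Finset.sum_congr rfl fun k _ => ?_
    have : (C y * (C r * X + C s)) ^ k * (C p * X + C q) ^ (N - k) *
        (N.choose k : Polynomial ℝ) =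
        C (y ^ k * N.choose k) * ((C p * X + C q) ^ (N - k) * (C r * X + C s) ^ k) := by
      rw [mul_pow, C_mul, C_pow, map_natCast]
      ring
    rw [this, coeff_C_mul]
    ring
  have h := congrArg (fun P => P.coeff j) key
  rw [finsetSum_coeff, coeff_C_mul] at h
  simp_rw [coeff_C_mul_X_pow] at h
  rwa [Finset.sum_ite_eq, if_pos (Finset.mem_range.mpr (Nat.lt_succ_of_le hj))] at h

/-- With `t = C² - S²`, the cosine of the full angle, `1 - (t + X)² = (1 - t - X)(1 + t + X)`, and
`1 - t = 2S²`, `1 + t = 2C²`. -/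
lemma taylor_one_sub_X_sq_pow (S C : ℝ) (h : C ^ 2 + S ^ 2 = 1) (ℓ : ℕ) :
    Polynomial.taylor (C ^ 2 - S ^ 2) ((1 - Polynomial.X ^ 2) ^ ℓ) =
      ((Polynomial.C (2 * S ^ 2) - Polynomial.X) *
        (Polynomial.C (2 * C ^ 2) + Polynomial.X)) ^ ℓ := by
  have e1 : 2 * S ^ 2 = 1 - (C ^ 2 - S ^ 2) := by linear_combination h
  have e2 : 2 * C ^ 2 = 1 + (C ^ 2 - S ^ 2) := by linear_combination h
  rw [e1, e2, Polynomial.taylor_apply]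
  simp only [Polynomial.pow_comp, Polynomial.sub_comp, Polynomial.one_comp, Polynomial.X_comp,
    Polynomial.C_sub, Polynomial.C_add, Polynomial.C_1]
  ring

lemma eval_iterate_derivative (k : ℕ) (f : Polynomial ℝ) (t : ℝ) :
    (Polynomial.derivative^[k] f).eval t = k.factorial * (Polynomial.taylor t f).coeff k := by
  rw [Polynomial.taylor_coeff, ← Polynomial.factorial_smul_hasseDeriv]
  simp

/-- Rodrigues' formula in terms of the half angle. -/
lemma zpow_mul_eval_iterate_derivative (S C : ℝ) (h : C ^ 2 + S ^ 2 = 1) (ℓ k : ℕ) (n : ℤ)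
    (hk : (k : ℤ) = ℓ + n) :
    (2 * S * C) ^ n *
        (Polynomial.derivative^[k] ((1 - Polynomial.X ^ 2) ^ ℓ)).eval (C ^ 2 - S ^ 2) =
      k.factorial * (-2) ^ ℓ * ((Polynomial.C S * Polynomial.X + Polynomial.C C) ^ ℓ *
        (Polynomial.C C * Polynomial.X + Polynomial.C (-S)) ^ ℓ).coeff k := by
  rw [eval_iterate_derivative, taylor_one_sub_X_sq_pow S C h]
  -- These are the poles, where `2SC` cannot be cancelled. There `(SX + C)(CX - S)` collapses to
  -- `(C² - S²)X`, so only `k = ℓ`, that is `n = 0`, contributes; for every other `n`, even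
  -- negative, `0 ^ n = 0` agrees with this.
  by_cases h0 : 2 * S * C = 0
  · have hSC : S = 0 ∨ C = 0 := by simpa using h0
    have hcoeff : ((Polynomial.C S * Polynomial.X + Polynomial.C C) ^ ℓ *
        (Polynomial.C C * Polynomial.X + Polynomial.C (-S)) ^ ℓ).coeff k =
        if k = ℓ then (C ^ 2 - S ^ 2) ^ ℓ else 0 := by
      have : (Polynomial.C S * Polynomial.X + Polynomial.C C) ^ ℓ *
        (Polynomial.C C * Polynomial.X + Polynomial.C (-S)) ^ ℓ =
        Polynomial.C ((C ^ 2 - S ^ 2) ^ ℓ) * Polynomial.X ^ ℓ := by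
        rw [← mul_pow, Polynomial.C_pow, ← mul_pow]
        congr 1
        rcases hSC with rfl | rfl <;> simp <;> ring
      rw [this, Polynomial.coeff_C_mul_X_pow]
    rw [hcoeff, h0]
    by_cases hn : n = 0
    · have hkl : k = ℓ := by omega
      subst hkl
      have ht : (((Polynomial.C (2 * S ^ 2) - Polynomial.X) *
          (Polynomial.C (2 * C ^ 2) + Polynomial.X)) ^ k).coeff k =
          (-2) ^ k * (C ^ 2 - S ^ 2) ^ k := by
        have : (Polynomial.C (2 * S ^ 2) - Polynomial.X) *
            (Polynomial.C (2 * C ^ 2) + Polynomial.X) =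
            Polynomial.X * (Polynomial.C (-2 * (C ^ 2 - S ^ 2)) - Polynomial.X) := by
          rcases hSC with rfl | rfl <;> simp <;> ring
        rw [this, mul_pow, Polynomial.coeff_X_pow_mul', if_pos le_rfl, Nat.sub_self,
          Polynomial.coeff_zero_eq_eval_zero]
        rw [← mul_pow]
        simp
      rw [ht, hn]
      simp
      ring
    · have hkl : k ≠ ℓ := by omega
      simp [hkl, zero_zpow n hn]
  -- The substitution `X ↦ 2SC X` turns `(2S² - X)(2C² + X)` into `-2 · 2SC (SX + C)(CX - S)`. It
  -- scales the coefficient of index `k = ℓ + n` by `(2SC)^(ℓ + n)`, and `(2SC)^ℓ` cancels.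
  · have hcomp := congrArg (fun P => P.coeff k)
      (show (((Polynomial.C (2 * S ^ 2) - Polynomial.X) *
          (Polynomial.C (2 * C ^ 2) + Polynomial.X)) ^ ℓ).comp
          (Polynomial.C (2 * S * C) * Polynomial.X) =
        Polynomial.C ((2 * S * C) ^ ℓ * (-2) ^ ℓ) *
          ((Polynomial.C S * Polynomial.X + Polynomial.C C) ^ ℓ *
          (Polynomial.C C * Polynomial.X + Polynomial.C (-S)) ^ ℓ) by
        rw [← mul_pow, ← mul_pow, Polynomial.C_pow, ← mul_pow, Polynomial.pow_comp]
        congr 1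
        simp only [Polynomial.mul_comp, Polynomial.sub_comp, Polynomial.add_comp,
          Polynomial.C_comp, Polynomial.X_comp, Polynomial.C_mul, Polynomial.C_neg,
          Polynomial.C_pow, Polynomial.pow_comp]
        ring)
    simp only [Polynomial.comp_C_mul_X_coeff, Polynomial.coeff_C_mul] at hcomp
    have hz : (2 * S * C) ^ k = (2 * S * C) ^ ℓ * (2 * S * C) ^ n := by
      rw [← zpow_natCast, hk, zpow_add₀ h0, zpow_natCast]
    have hl : (2 * S * C) ^ ℓ ≠ 0 := pow_ne_zero _ h0
    rw [hz] at hcomp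
    apply mul_left_cancel₀ hl
    linear_combination (k.factorial : ℝ) * hcomp

/-- The normalizing factor of `ψ_m`. -/
noncomputable def psiScale (ε : ℝ) (ℓ : ℕ) (m : ℤ) : ℝ :=
  ε ^ m / √((((ℓ : ℤ) - m).toNat.factorial * ((ℓ : ℤ) + m).toNat.factorial : ℕ) : ℝ)

/-- The basis vectors are monomials, so one term survives in each of the sums defining `polyRep` and
`polyInner`. -/
lemma matrixElementSU2_eq (ε : ℝ) (ℓ : ℕ) (m n : ℤ) (hm : |m| ≤ (ℓ : ℤ)) (hn : |n| ≤ (ℓ : ℤ))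
    (g : SU2) :
    matrixElementSU2 ε ℓ m n g =
      ((psiScale ε ℓ n * psiScale ε ℓ m *
        (((ℓ : ℤ) - m).toNat.factorial * ((ℓ : ℤ) + m).toNat.factorial : ℕ) : ℝ) : ℂ) *
      ((Polynomial.C (g.1 1 1) * Polynomial.X - Polynomial.C (g.1 0 1)) ^ ((ℓ : ℤ) - n).toNat *
        (Polynomial.C (g.1 0 0) - Polynomial.C (g.1 1 0) * Polynomial.X) ^
          ((ℓ : ℤ) + n).toNat).coeff ((ℓ : ℤ) - m).toNat := by
  rw [abs_le] at hm hn
  have h1 : 2 * ℓ - ((ℓ : ℤ) - n).toNat = ((ℓ : ℤ) + n).toNat := by omega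
  have h2 : 2 * ℓ - ((ℓ : ℤ) - m).toNat = ((ℓ : ℤ) + m).toNat := by omega
  have hrep : polyRep ℓ g.1 (psi ε ℓ n) = Polynomial.C (psiScale ε ℓ n : ℂ) *
      ((Polynomial.C (g.1 1 1) * Polynomial.X - Polynomial.C (g.1 0 1)) ^ ((ℓ : ℤ) - n).toNat *
        (Polynomial.C (g.1 0 0) - Polynomial.C (g.1 1 0) * Polynomial.X) ^
          ((ℓ : ℤ) + n).toNat) := by
    rw [polyRep, Finset.sum_eq_single ((ℓ : ℤ) - n).toNat]
    · rw [psi, Polynomial.coeff_C_mul_X_pow, if_pos rfl, h1, mul_assoc]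
      rfl
    · intro k _ hk
      rw [psi, Polynomial.coeff_C_mul_X_pow, if_neg hk]
      simp
    · intro h
      exact absurd (Finset.mem_range.mpr (by omega)) h
  rw [matrixElementSU2, polyInner, hrep, Finset.sum_eq_single ((ℓ : ℤ) - m).toNat]
  · rw [psi, Polynomial.coeff_C_mul_X_pow, if_pos rfl, h2, Polynomial.coeff_C_mul,
      Complex.conj_ofReal]
    simp only [psiScale]
    push_cast
    ring
  · intro k _ hk
    rw [psi, Polynomial.coeff_C_mul_X_pow, if_neg hk]
    simp
  · intro h
    exact absurd (Finset.mem_range.mpr (by omega)) h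

/-! ### Rotations around the `z` axis: fibres of the orbit map and equivariance of the matrix
elements -/

lemma rotZ_mul_rotZ (a b : ℝ) : rotZ a * rotZ b = rotZ (a + b) := by
  apply Subtype.ext
  ext i j
  fin_cases i <;> fin_cases j <;>
    simp [rotZ, Real.cos_add, Real.sin_add] <;> ring

lemma rotZ_zero : rotZ 0 = 1 := by
  apply Subtype.ext
  ext i j
  fin_cases i <;> fin_cases j <;> simp [rotZ]

lemma rotZ_inv (a : ℝ) : (rotZ a)⁻¹ = rotZ (-a) :=
  inv_eq_of_mul_eq_one_right (by rw [rotZ_mul_rotZ, add_neg_cancel, rotZ_zero])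

lemma rotY_inv (b : ℝ) : (rotY b)⁻¹ = rotY (-b) := by
  apply inv_eq_of_mul_eq_one_right
  apply Subtype.ext
  have h := Real.cos_sq_add_sin_sq b
  ext i j
  fin_cases i <;> fin_cases j <;>
    simp [rotY] <;>
    first | linear_combination h | ring

lemma orbitMap_mul_rotZ (u : SO3) (γ : ℝ) : orbitMap (u * rotZ γ) = orbitMap u := by
  rw [orbitMap, orbitMap, rotateS2_mul]
  congr 1
  apply Subtype.ext
  change (orbitMap (rotZ γ)).1 = _
  rw [orbitMap_eq]
  simp [rotZ, northPole]

/-- The fibres of the orbit map are the cosets of the rotations around the `z` axis. -/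
lemma exists_eq_mul_rotZ {u v : SO3} (h : orbitMap u = orbitMap v) : ∃ γ, u = v * rotZ γ := by
  obtain ⟨α, β, γ, hk⟩ := exists_euler (v⁻¹ * u)
  have hν : orbitMap (v⁻¹ * u) = northPole := by
    rw [orbitMap, rotateS2_mul]
    change rotateS2 v⁻¹ (orbitMap u) = _
    rw [h, orbitMap, ← rotateS2_mul, inv_mul_cancel, rotateS2_one]
  rw [hk, orbitMap_mul_rotZ] at hν
  -- The height of `Z(α)Y(β)ν` is `cos β`. Since this point is the pole, `Y(β)` is trivial and the
  -- two rotations around the `z` axis merge.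
  have hc : Real.cos β = 1 := by
    have := congrArg (fun x : S2 => x.1 2) hν
    simpa [orbitMap_eq, rotZ, rotY, northPole] using this
  have hs : Real.sin β = 0 := by
    have := Real.cos_sq_add_sin_sq β
    rw [hc] at this
    exact pow_eq_zero_iff two_ne_zero |>.mp (by linarith)
  have hY : rotY β = 1 := by
    apply Subtype.ext
    ext i j
    fin_cases i <;> fin_cases j <;> simp [rotY, hc, hs]
  refine ⟨α + γ, ?_⟩
  rw [← rotZ_mul_rotZ, ← mul_one (rotZ α), ← hY, ← hk, mul_inv_cancel_left]

lemma su2Z_apply_zero (α : ℝ) : (su2Z α).1 0 0 = Complex.exp (-(α / 2) * Complex.I) := by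
  rw [Complex.exp_mul_I, Complex.cos_neg, Complex.sin_neg]
  simp [su2Z]
  ring

lemma su2Z_apply_one (α : ℝ) : (su2Z α).1 1 1 = Complex.exp ((α / 2) * Complex.I) := by
  rw [Complex.exp_mul_I]
  simp [su2Z]

/-- Left multiplication by `diag(w, z)` scales the rows. As `z = w z²`, this is an overall factor
`w^(2ℓ)` and the substitution `X ↦ z² X`, so the coefficient of index `ℓ - m` acquires `w^(2ℓ)
z^(2(ℓ - m)) = e^{-imγ}`. -/
lemma wignerD_rotZ_mul (ε : ℝ) (ℓ : ℕ) (m n : ℤ) (hm : |m| ≤ (ℓ : ℤ)) (hn : |n| ≤ (ℓ : ℤ))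
    (γ : ℝ) (v : SO3) :
    wignerD ε ℓ m n (rotZ γ * v) = Complex.exp (-(Complex.I * m * γ)) * wignerD ε ℓ m n v := by
  rw [wignerD_eq_of_covers ε ℓ m n ((covers_Z γ).mul (covers_coverLift v)), wignerD,
    matrixElementSU2_eq ε ℓ m n hm hn, matrixElementSU2_eq ε ℓ m n hm hn]
  generalize coverLift v = g
  set w := Complex.exp (-(γ / 2) * Complex.I) with hw
  set z := Complex.exp ((γ / 2) * Complex.I) with hz
  have hwz : w * z ^ 2 = z := by
    rw [hw, hz, ← Complex.exp_nat_mul, ← Complex.exp_add]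
    congr 1
    push_cast
    ring
  have hrow0 (j : Fin 2) : (su2Z γ * g).1 0 j = w * g.1 0 j := by
    rw [hw, ← su2Z_apply_zero]
    change ((su2Z γ).1 * g.1) 0 j = _
    rw [Matrix.mul_apply, Fin.sum_univ_two]
    simp [su2Z]
  have hrow1 (j : Fin 2) : (su2Z γ * g).1 1 j = z * g.1 1 j := by
    rw [hz, ← su2Z_apply_one]
    change ((su2Z γ).1 * g.1) 1 j = _
    rw [Matrix.mul_apply, Fin.sum_univ_two]
    simp [su2Z]
  rw [hrow0, hrow0, hrow1, hrow1, ← hwz]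
  rw [abs_le] at hm hn
  have hpoly : (Polynomial.C (w * z ^ 2 * g.1 1 1) * Polynomial.X - Polynomial.C (w * g.1 0 1)) ^
        ((ℓ : ℤ) - n).toNat *
      (Polynomial.C (w * g.1 0 0) - Polynomial.C (w * z ^ 2 * g.1 1 0) * Polynomial.X) ^
        ((ℓ : ℤ) + n).toNat =
      Polynomial.C (w ^ (2 * ℓ)) * ((Polynomial.C (g.1 1 1) * Polynomial.X -
        Polynomial.C (g.1 0 1)) ^ ((ℓ : ℤ) - n).toNat *
        (Polynomial.C (g.1 0 0) - Polynomial.C (g.1 1 0) * Polynomial.X) ^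
          ((ℓ : ℤ) + n).toNat).comp (Polynomial.C (z ^ 2) * Polynomial.X) := by
    have e : 2 * ℓ = ((ℓ : ℤ) - n).toNat + ((ℓ : ℤ) + n).toNat := by omega
    rw [e, Polynomial.C_pow, pow_add]
    simp only [Polynomial.mul_comp, Polynomial.pow_comp, Polynomial.sub_comp, Polynomial.C_comp,
      Polynomial.X_comp]
    rw [mul_mul_mul_comm, ← mul_pow, ← mul_pow]
    congr 2 <;> simp only [Polynomial.C_mul] <;> ring
  rw [hpoly, Polynomial.coeff_C_mul, Polynomial.comp_C_mul_X_coeff]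
  have hexp : w ^ (2 * ℓ) * (z ^ 2) ^ ((ℓ : ℤ) - m).toNat =
      Complex.exp (-(Complex.I * m * γ)) := by
    have hmc : ((((ℓ : ℤ) - m).toNat : ℕ) : ℂ) = ℓ - m := by
      have : ((((ℓ : ℤ) - m).toNat : ℕ) : ℤ) = ℓ - m := by omega
      exact_mod_cast this
    rw [hw, hz, ← pow_mul, ← Complex.exp_nat_mul, ← Complex.exp_nat_mul, ← Complex.exp_add]
    congr 1
    push_cast
    rw [hmc]
    ring
  rw [← hexp]
  ring

/-- Right multiplication scales the columns, so the two linear forms acquire the factors `z` and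
`w`, and `z^(ℓ - n) w^(ℓ + n) = e^{-inγ}`. -/
lemma wignerD_mul_rotZ (ε : ℝ) (ℓ : ℕ) (m n : ℤ) (hm : |m| ≤ (ℓ : ℤ)) (hn : |n| ≤ (ℓ : ℤ))
    (γ : ℝ) (v : SO3) :
    wignerD ε ℓ m n (v * rotZ γ) = Complex.exp (-(Complex.I * n * γ)) * wignerD ε ℓ m n v := by
  rw [wignerD_eq_of_covers ε ℓ m n ((covers_coverLift v).mul (covers_Z γ)), wignerD,
    matrixElementSU2_eq ε ℓ m n hm hn, matrixElementSU2_eq ε ℓ m n hm hn]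
  generalize coverLift v = g
  set w := Complex.exp (-(γ / 2) * Complex.I) with hw
  set z := Complex.exp ((γ / 2) * Complex.I) with hz
  have hcol0 (i : Fin 2) : (g * su2Z γ).1 i 0 = w * g.1 i 0 := by
    rw [hw, ← su2Z_apply_zero]
    change (g.1 * (su2Z γ).1) i 0 = _
    rw [Matrix.mul_apply, Fin.sum_univ_two]
    simp [su2Z, mul_comm]
  have hcol1 (i : Fin 2) : (g * su2Z γ).1 i 1 = z * g.1 i 1 := by
    rw [hz, ← su2Z_apply_one]
    change (g.1 * (su2Z γ).1) i 1 = _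
    rw [Matrix.mul_apply, Fin.sum_univ_two]
    simp [su2Z, mul_comm]
  rw [hcol0, hcol0, hcol1, hcol1]
  have e1 : Polynomial.C (z * g.1 1 1) * Polynomial.X - Polynomial.C (z * g.1 0 1) =
      Polynomial.C z * (Polynomial.C (g.1 1 1) * Polynomial.X - Polynomial.C (g.1 0 1)) := by
    simp only [Polynomial.C_mul]; ring
  have e2 : Polynomial.C (w * g.1 0 0) - Polynomial.C (w * g.1 1 0) * Polynomial.X =
      Polynomial.C w * (Polynomial.C (g.1 0 0) - Polynomial.C (g.1 1 0) * Polynomial.X) := by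
    simp only [Polynomial.C_mul]; ring
  rw [e1, e2, mul_pow, mul_pow, mul_mul_mul_comm, ← Polynomial.C_pow, ← Polynomial.C_pow,
    ← Polynomial.C_mul, Polynomial.coeff_C_mul]
  have hexp : z ^ ((ℓ : ℤ) - n).toNat * w ^ ((ℓ : ℤ) + n).toNat =
      Complex.exp (-(Complex.I * n * γ)) := by
    rw [abs_le] at hn
    have h1 : ((((ℓ : ℤ) - n).toNat : ℕ) : ℂ) = ℓ - n := by
      have : ((((ℓ : ℤ) - n).toNat : ℕ) : ℤ) = ℓ - n := by omega
      exact_mod_cast this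
    have h2 : ((((ℓ : ℤ) + n).toNat : ℕ) : ℂ) = ℓ + n := by
      have : ((((ℓ : ℤ) + n).toNat : ℕ) : ℤ) = ℓ + n := by omega
      exact_mod_cast this
    rw [hw, hz, ← Complex.exp_nat_mul, ← Complex.exp_nat_mul, ← Complex.exp_add, h1, h2]
    congr 1
    ring
  rw [← hexp]
  ring

/-! ### The row `m = 0` and the spherical harmonics -/

/-- With `S`, `C` the sine and cosine of `β/2`, the left side is a multiple of the coefficient of
`x^ℓ` in `(Cx - S)^(ℓ - n) (Sx + C)^(ℓ + n)`, the right side one of the coefficient of `x^(ℓ + n)`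
in `(Sx + C)^ℓ (Cx - S)^ℓ`. The range of `β` makes `√(1 - cos² β)` equal to `sin β`. -/
lemma wignerD_zero_rotY (ε : ℝ) (ℓ : ℕ) (n : ℤ) (hn : |n| ≤ (ℓ : ℤ)) (β : ℝ)
    (h0 : 0 ≤ β) (hπ : β ≤ Real.pi) :
    wignerD ε ℓ 0 n (rotY (-β)) = ((√(((ℓ : ℤ) - n).toNat.factorial /
      ((ℓ : ℤ) + n).toNat.factorial) * assocLegendre ε ℓ n (Real.cos β) : ℝ) : ℂ) := by
  have hsq := Real.cos_sq_add_sin_sq (β / 2)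
  have hcos : Real.cos β = Real.cos (β / 2) ^ 2 - Real.sin (β / 2) ^ 2 := by
    rw [← Real.cos_two_mul']; congr 1; ring
  have hsin : √(1 - Real.cos β ^ 2) = 2 * Real.sin (β / 2) * Real.cos (β / 2) := by
    rw [← Real.sin_two_mul, ← Real.sin_sq, Real.sqrt_sq (by
      exact Real.sin_nonneg_of_nonneg_of_le_pi h0 hπ)]
    congr 1; ring
  have hmat : matrixElementSU2 ε ℓ 0 n (su2Y (-β)) =
      ((psiScale ε ℓ n * psiScale ε ℓ 0 * (ℓ.factorial * ℓ.factorial) *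
      ((Polynomial.C (Real.cos (β / 2)) * Polynomial.X +
        Polynomial.C (-Real.sin (β / 2))) ^ ((ℓ : ℤ) - n).toNat *
      (Polynomial.C (Real.sin (β / 2)) * Polynomial.X +
        Polynomial.C (Real.cos (β / 2))) ^ ((ℓ : ℤ) + n).toNat).coeff ℓ : ℝ) : ℂ) := by
    rw [matrixElementSU2_eq ε ℓ 0 n (by simp) hn]
    have hmap : (Polynomial.C ((su2Y (-β)).1 1 1) * Polynomial.X -
        Polynomial.C ((su2Y (-β)).1 0 1)) ^ ((ℓ : ℤ) - n).toNat *
        (Polynomial.C ((su2Y (-β)).1 0 0) - Polynomial.C ((su2Y (-β)).1 1 0) * Polynomial.X) ^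
          ((ℓ : ℤ) + n).toNat =
        ((Polynomial.C (Real.cos (β / 2)) * Polynomial.X +
        Polynomial.C (-Real.sin (β / 2))) ^ ((ℓ : ℤ) - n).toNat *
      (Polynomial.C (Real.sin (β / 2)) * Polynomial.X +
        Polynomial.C (Real.cos (β / 2))) ^ ((ℓ : ℤ) + n).toNat).map Complex.ofRealHom := by
      simp only [Polynomial.map_mul, Polynomial.map_pow, Polynomial.map_add, Polynomial.map_C,
        Polynomial.map_X]
      congr 2
      · simp [su2Y, neg_div, sub_eq_add_neg]
      · simp [su2Y, neg_div, add_comm]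
    rw [hmap, Polynomial.coeff_map]
    simp
  rw [wignerD_eq_of_covers ε ℓ 0 n (covers_Y (-β)), hmat, Complex.ofReal_inj]
  rw [abs_le] at hn
  obtain ⟨a, ha⟩ : ∃ a, a = ((ℓ : ℤ) - n).toNat := ⟨_, rfl⟩
  obtain ⟨b, hb⟩ : ∃ b, b = ((ℓ : ℤ) + n).toNat := ⟨_, rfl⟩
  have hab : a + b = 2 * ℓ := by omega
  have hsymm := choose_mul_coeff_symm (Real.cos (β / 2)) (-Real.sin (β / 2)) (Real.sin (β / 2))
    (Real.cos (β / 2)) (N := 2 * ℓ) (i := ℓ) (j := b) (by omega)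
  have hrod := zpow_mul_eval_iterate_derivative (Real.sin (β / 2)) (Real.cos (β / 2)) hsq ℓ b n
    (by omega)
  rw [show 2 * ℓ - b = a by omega, show 2 * ℓ - ℓ = ℓ by omega] at hsymm
  rw [assocLegendre, hsin, hcos]
  simp only [psiScale, ← ha, ← hb, sub_zero, add_zero, Int.toNat_natCast, zpow_zero]
  rw [mul_assoc _ ((2 * Real.sin (β / 2) * Real.cos (β / 2)) ^ n), hrod]
  set K := ((Polynomial.C (Real.sin (β / 2)) * Polynomial.X +
    Polynomial.C (Real.cos (β / 2))) ^ ℓ * (Polynomial.C (Real.cos (β / 2)) * Polynomial.X +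
      Polynomial.C (-Real.sin (β / 2))) ^ ℓ).coeff b
  set c := ((Polynomial.C (Real.cos (β / 2)) * Polynomial.X +
    Polynomial.C (-Real.sin (β / 2))) ^ a * (Polynomial.C (Real.sin (β / 2)) * Polynomial.X +
      Polynomial.C (Real.cos (β / 2))) ^ b).coeff ℓ
  have hA : (0 : ℝ) < a.factorial := by positivity
  have hB : (0 : ℝ) < b.factorial := by positivity
  have hL : (0 : ℝ) < ℓ.factorial := by positivity
  have f1 : ((2 * ℓ).choose b : ℝ) * b.factorial * a.factorial = (2 * ℓ).factorial := by
    have := Nat.choose_mul_factorial_mul_factorial (n := 2 * ℓ) (k := b) (by omega)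
    rw [show 2 * ℓ - b = a by omega] at this
    exact_mod_cast this
  have f2 : ((2 * ℓ).choose ℓ : ℝ) * ℓ.factorial * ℓ.factorial = (2 * ℓ).factorial := by
    have := Nat.choose_mul_factorial_mul_factorial (n := 2 * ℓ) (k := ℓ) (by omega)
    rw [show 2 * ℓ - ℓ = ℓ by omega] at this
    exact_mod_cast this
  -- The coefficient symmetry with its two binomials of `2ℓ` written out in factorials; `(2ℓ)!`
  -- cancels.
  have hc : ℓ.factorial * ℓ.factorial * c = a.factorial * b.factorial * K := by
    have hF : ((2 * ℓ).factorial : ℝ) ≠ 0 := by positivity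
    apply mul_left_cancel₀ hF
    nth_rewrite 1 [← f1]
    rw [← f2]
    linear_combination (b.factorial * a.factorial * ℓ.factorial * ℓ.factorial : ℝ) * hsymm
  push_cast
  rw [Real.sqrt_mul_self hL.le, Real.sqrt_mul hA.le, Real.sqrt_div hA.le]
  have sA := Real.sq_sqrt hA.le
  have sB := Real.sq_sqrt hB.le
  have sA0 : √(a.factorial : ℝ) ≠ 0 := (Real.sqrt_pos.mpr hA).ne'
  have sB0 : √(b.factorial : ℝ) ≠ 0 := (Real.sqrt_pos.mpr hB).ne'
  -- The sign in the Legendre function cancels the one produced by Rodrigues' formula.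
  have h2 : ((-1 : ℝ) ^ ℓ) * (-2) ^ ℓ = 2 ^ ℓ := by rw [← mul_pow]; norm_num
  have hc' : ℓ.factorial * ℓ.factorial * c =
      √(a.factorial : ℝ) ^ 2 * √(b.factorial : ℝ) ^ 2 * K := by rw [sA, sB, hc]
  have lhs : ε ^ n / (√(a.factorial : ℝ) * √(b.factorial : ℝ)) * (1 / ℓ.factorial) *
      (ℓ.factorial * ℓ.factorial) * c =
      ε ^ n * √(a.factorial : ℝ) * √(b.factorial : ℝ) / ℓ.factorial * K := by
    rw [mul_assoc, hc']
    field_simp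
  rw [lhs]
  have rhs : √(a.factorial : ℝ) / √(b.factorial : ℝ) * ((-1) ^ ℓ * ε ^ n / (2 ^ ℓ * ℓ.factorial) *
      (b.factorial * (-2) ^ ℓ * K)) =
      √(a.factorial : ℝ) / √(b.factorial : ℝ) * (ε ^ n * (((-1) ^ ℓ) * (-2) ^ ℓ) /
      (2 ^ ℓ * ℓ.factorial) * (√(b.factorial : ℝ) ^ 2 * K)) := by
    rw [sB]; ring
  rw [rhs, h2]
  field_simp

/-- The matrix elements with `m = 0` are multiples of spherical harmonics. -/
lemma wignerD_zero_inv (ε : ℝ) (ℓ : ℕ) (n : ℤ) (hn : |n| ≤ (ℓ : ℤ)) (u : SO3) :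
    wignerD ε ℓ 0 n u⁻¹ =
      ((√(4 * Real.pi / (2 * ℓ + 1)) : ℝ) : ℂ) * sphHarm ε ℓ n (orbitMap u) := by
  -- Hence `u⁻¹ = Z(-γ)Y(-θ)Z(-φ)` with `θ`, `φ` the angles of `uν`. The left factor acts trivially
  -- because `m = 0`, and the right one contributes `e^{inφ}`.
  obtain ⟨γ, hu⟩ := exists_eq_mul_rotZ (orbitMap_sphereSection (orbitMap u)).symm
  generalize orbitMap u = x at hu ⊢
  rw [hu, mul_inv_rev, rotZ_inv, wignerD_rotZ_mul ε ℓ 0 n (by simp) hn, sphereSection,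
    mul_inv_rev, rotZ_inv, rotY_inv, wignerD_mul_rotZ ε ℓ 0 n (by simp) hn,
    wignerD_zero_rotY ε ℓ n hn _ (Real.arccos_nonneg _) (Real.arccos_le_pi _), sphHarm,
    sphHarmAngle]
  have hs : √(4 * Real.pi / (2 * ℓ + 1)) * √((2 * ℓ + 1) / (4 * Real.pi) *
      (((ℓ : ℤ) - n).toNat.factorial / ((ℓ : ℤ) + n).toNat.factorial)) =
      √(((ℓ : ℤ) - n).toNat.factorial / ((ℓ : ℤ) + n).toNat.factorial) := by
    have hp : (0 : ℝ) < 2 * ℓ + 1 := by positivity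
    rw [← Real.sqrt_mul (by positivity)]
    congr 1
    have := Real.pi_pos
    field_simp
  rw [← hs]
  push_cast
  simp only [mul_zero, zero_mul, neg_zero, Complex.exp_zero, one_mul, mul_neg, neg_neg]
  ring

/-! ### Continuity of the harmonics and the integral formula -/

/-- The defining formula uses `arg`, which jumps, and possibly negative powers at the poles. The
orbit map is a closed surjection, hence a quotient map, so continuity can be checked on `SO(3)`,
where the function is a multiple of a matrix element. -/
lemma continuous_sphHarm (ε : ℝ) (ℓ : ℕ) (n : ℤ) (hn : |n| ≤ (ℓ : ℤ)) :
    Continuous (sphHarm ε ℓ n) := by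
  have hq : Topology.IsQuotientMap orbitMap :=
    continuous_orbitMap.isClosedMap.isQuotientMap continuous_orbitMap surjective_orbitMap
  rw [hq.continuous_iff]
  have hc : ((√(4 * Real.pi / (2 * ℓ + 1)) : ℝ) : ℂ) ≠ 0 := by
    rw [Complex.ofReal_ne_zero]
    have := Real.pi_pos
    positivity
  have h : sphHarm ε ℓ n ∘ orbitMap = fun u =>
      ((√(4 * Real.pi / (2 * ℓ + 1)) : ℝ) : ℂ)⁻¹ * wignerD ε ℓ 0 n u⁻¹ := by
    funext u
    rw [wignerD_zero_inv ε ℓ n hn, Function.comp_apply, inv_mul_cancel_left₀ hc]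
  rw [h]
  exact continuous_const.mul ((continuous_wignerD ε ℓ 0 n).comp continuous_inv)

lemma integrable_mul_conj_of_continuous {X : Type*} [TopologicalSpace X] [CompactSpace X]
    [MeasurableSpace X] [BorelSpace X] {μ : Measure X} {f g : X → ℂ} (hf : Integrable f μ)
    (hg : Continuous g) : Integrable (fun x => f x * conj (g x)) μ := by
  obtain ⟨c, hc⟩ := isCompact_univ.exists_bound_of_continuousOn hg.continuousOn
  refine hf.mul_bdd (c := c) ?_ (Filter.Eventually.of_forall fun x => ?_)
  · exact (Complex.continuous_conj.comp hg).aestronglyMeasurable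
  · rw [RCLike.norm_conj]
    exact hc x trivial

theorem mainTheorem6 (ε : ℝ) (hε : ε = 1 ∨ ε = -1) (f : S2 → ℂ) (hf : MemLp f 2 areaS2)
    (ℓ : ℕ) (m n : ℤ) (hm : |m| ≤ (ℓ : ℤ)) (hn : |n| ≤ (ℓ : ℤ)) :
    Integrable (fun x => f x * conj (sphHarm ε ℓ n x)) areaS2 ∧
    Integrable (fun u => f (rotateS2 u northPole) * conj (wignerD ε ℓ m n u⁻¹)) haarSO3 ∧
    (m = 0 →
      ∫ u, f (rotateS2 u northPole) * conj (wignerD ε ℓ m n u⁻¹) ∂haarSO3 =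
        ((2 * Real.pi * √(4 * Real.pi / (2 * ℓ + 1)) : ℝ) : ℂ) * sphCoeff ε f ℓ n) ∧
    (m ≠ 0 →
      ∫ u, f (rotateS2 u northPole) * conj (wignerD ε ℓ m n u⁻¹) ∂haarSO3 = 0) := by
  have hfi : Integrable f areaS2 := hf.integrable (by norm_num)
  have hfS := integrable_mul_conj_of_continuous hfi (continuous_sphHarm ε ℓ n hn)
  have hfm : Integrable f (haarSO3.map orbitMap) := by
    rw [map_orbitMap_haarSO3]
    exact hfi.smul_measure ENNReal.ofReal_ne_top
  have hfo : Integrable (fun u => f (orbitMap u)) haarSO3 :=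
    hfm.comp_measurable continuous_orbitMap.measurable
  refine ⟨hfS, integrable_mul_conj_of_continuous hfo
    ((continuous_wignerD ε ℓ m n).comp continuous_inv), ?_, fun hm0 => ?_⟩
  · rintro rfl
    have h1 (u : SO3) : f (rotateS2 u northPole) * conj (wignerD ε ℓ 0 n u⁻¹) =
        ((√(4 * Real.pi / (2 * ℓ + 1)) : ℝ) : ℂ) *
          (fun x => f x * conj (sphHarm ε ℓ n x)) (orbitMap u) := by
      rw [wignerD_zero_inv ε ℓ n hn, map_mul, Complex.conj_ofReal]
      simp only [orbitMap]
      ring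
    simp_rw [h1]
    have h2 : AEStronglyMeasurable (fun x => f x * conj (sphHarm ε ℓ n x))
        (haarSO3.map orbitMap) := by
      rw [map_orbitMap_haarSO3]
      exact hfS.aestronglyMeasurable.smul_measure _
    rw [integral_const_mul, ← integral_map continuous_orbitMap.aemeasurable h2,
      map_orbitMap_haarSO3, integral_smul_measure, ENNReal.toReal_ofReal (by positivity),
      sphCoeff, Complex.real_smul]
    push_cast
    ring
  · have hmc : (m : ℂ) ≠ 0 := Int.cast_ne_zero.mpr hm0
    -- Right translation by `Z(π/m)` fixes `f(uν)` and multiplies the matrix element at `u⁻¹` by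
    -- `e^{iπ} = -1`.
    have h1 := integral_mul_right_eq_self (μ := haarSO3)
      (fun u => f (orbitMap u) * conj (wignerD ε ℓ m n u⁻¹)) (rotZ (Real.pi / m))
    have h2 (u : SO3) : f (orbitMap (u * rotZ (Real.pi / m))) *
        conj (wignerD ε ℓ m n (u * rotZ (Real.pi / m))⁻¹) =
        -(f (orbitMap u) * conj (wignerD ε ℓ m n u⁻¹)) := by
      rw [orbitMap_mul_rotZ, mul_inv_rev, rotZ_inv, wignerD_rotZ_mul ε ℓ m n hm hn]
      have : -(Complex.I * m * ((-(Real.pi / m) : ℝ) : ℂ)) = Real.pi * Complex.I := by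
        push_cast
        field_simp
      rw [this, Complex.exp_pi_mul_I]
      simp
    simp_rw [h2] at h1
    rw [integral_neg] at h1
    exact self_eq_neg.mp h1.symm
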